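/- **Definitions.** Let $\mathbb{K}$ be $\mathbb{R}$ or $\mathbb{C}$, and let $W$ be a vertex algebra over $\mathbb{K}$ with products $a(n)b$ ($n\in\mathbb{Z}$), vacuum vector $\mathbf{1}$ and $Ta=a(-2)\mathbf{1}$. Let $\mathrm{Aut}\,W$ be the group of linear bijections $f:W\to W$ with $f(\mathbf 1)=\mathbf 1$ and $f(a(n)b)=f(a)(n)f(b)$ for all $a,b\in W$, $n\in\mathbb{Z}$. The vertex algebra $W$ is simple if it is nonzero and its only two-sided ideals are $0$ and $W$. For $\omega\in W$ put $L(n)=\omega(n+1)$ and $W_n=\{v\in W\mid L(0)v=nv\}$ for $n\in\mathbb{Z}$. The vector $\omega$ is conformal if $W=\bigoplus_{n\in\mathbb{Z}}W_n$, $W_n(k)W_m\subset W_{n+m-k-1}$, $\mathbf 1\in W_0$, $\omega\in W_2$, $L(-1)=T$, and $[L(n),L(m)]=(n-m)L(n+m)+\tfrac{1}{12}\delta_{n+m,0}(n^3-n)c$ for some $c\in\mathbb{K}$. For conformal $\omega$, the pair $(W,\omega)$ is a VOA of CFT type if moreover $W_n=0$ for $n<0$, $\dim W_n<\infty$ for all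 $n$, and $W_0=\mathbb{K}\mathbf 1$; it is of strong CFT type if in addition $L(1)W_1=0$. Put $$J_1(W)=\{a\in W_1\mid a(0)=0\},\qquad \mathrm{Aut}_\omega W=\{f\in\mathrm{Aut}\,W\mid f(\omega)=\omega\},$$ $$\mathrm{Aut}^- W=\Big\{f\in\mathrm{Aut}\,W\ \Big|\ f(W_n)\subset\bigoplus_{k\le n}W_k\ \text{and}\ \mathrm{pr}_n\circ f|_{W_n}=\mathrm{id}_{W_n}\ \text{for all } n\in\mathbb{Z}\Big\},$$ where $\mathrm{pr}_n:W\to W_n$ is the projection; for conformal $\omega$, the last two are subgroups of $\mathrm{Aut}\,W$. Let $(V,\omega)$ be a VOA of CFT type over $\mathbb{C}$. An anti-involution of $(V,\omega)$ is an antilinear map $\sigma:V\to V$ with $\sigma^2=\mathrm{id}$, $\sigma(\mathbf 1)=\mathbf 1$, $\sigma(\omega)=\omega$ and $\sigma(a(n)b)=\sigma(a)(n)\sigma(b)$ for all $a,b,n$. The VOA $(V,\omega)$ is unitary with anti-involution $\sigma$ if there is a positive-definite Hermitian form $(\cdot,\cdot)$ on $V$, linear in the first variable, such that $$\big(Y(e^{zL(1)}(-z^{-2})^{L(0)}a,z^{-1})u,v\big)=\big(u,Y(\sigma(a),z)v\big)\qquad(a,u,v\in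 V),$$ where $Y(a,z)=\sum_{n\in\mathbb{Z}}a(n)z^{-n-1}$. In this case $V^\sigma=\{v\in V\mid\sigma(v)=v\}$, with the products and the vacuum vector of $V$, is a vertex algebra over $\mathbb{R}$ with conformal vector $\omega$. **Statement.** Let $(V,\omega)$ be a simple unitary VOA of strong CFT type over $\mathbb{C}$ with anti-involution $\sigma$. Then $\mathrm{Aut}(V^\sigma)$ is the (internal) semidirect product of its subgroups $\mathrm{Aut}^-V^\sigma$ and $\mathrm{Aut}_\omega V^\sigma$: the group $\mathrm{Aut}_\omega V^\sigma$ acts on $\mathrm{Aut}^-V^\sigma$ by conjugation, and the map $$\mathrm{Aut}^-V^\sigma\rtimes\mathrm{Aut}_\omega V^\sigma\to\mathrm{Aut}(V^\sigma),\qquad (f,g)\mapsto fg,$$ for this action is an isomorphism of groups. If moreover $J_1(V)=0$, then $\mathrm{Aut}(V^\sigma)=\mathrm{Aut}_\omega V^\sigma$. -/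

import Mathlib

open scoped ComplexConjugate

/-- A vertex algebra over `K`: the products `prod K n a b` stand for `a(n)b`. The last axiom is the
Borcherds identity. By truncation, its sums have only finitely many nonzero terms. -/
class VertexAlgebra (K V : Type*) [Field K] [AddCommGroup V] [Module K V] where
  /-- The `n`-th product `a(n)b`. -/
  prod (K) : ℤ → V →ₗ[K] V →ₗ[K] V
  /-- The vacuum vector. -/
  vac (K) (V) : V
  truncation : ∀ a b : V, ∃ N : ℤ, ∀ n : ℤ, N ≤ n → prod n a b = 0
  vac_prod : ∀ (n : ℤ) (a : V), prod n vac a = if n = -1 then a else 0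
  prod_vac_of_nonneg : ∀ (n : ℤ) (a : V), 0 ≤ n → prod n a vac = 0
  prod_vac_neg_one : ∀ a : V, prod (-1) a vac = a
  borcherds : ∀ (p q r : ℤ) (a b c : V),
    ∑ᶠ i : ℕ, Ring.choose p i • prod (p + q - i) (prod (r + i) a b) c =
      ∑ᶠ i : ℕ, ((-1) ^ i * Ring.choose r i) •
        (prod (p + r - i) a (prod (q + i) b c) -
          r.negOnePow • prod (q + r - i) b (prod (p + i) a c))

namespace VertexAlgebra

section General

variable (K : Type*) {V : Type*} [Field K] [AddCommGroup V] [Module K V] [VertexAlgebra K V]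

/-- A two-sided ideal of a vertex algebra. -/
def IsIdeal (I : Submodule K V) : Prop :=
  ∀ (n : ℤ) (a : V), ∀ x ∈ I, prod K n a x ∈ I ∧ prod K n x a ∈ I

variable (V) in
/-- A simple vertex algebra: nonzero, without ideals other than `0` and itself. -/
def IsSimple : Prop :=
  Nontrivial V ∧ ∀ I : Submodule K V, IsIdeal K I → I = ⊥ ∨ I = ⊤

/-- The translation operator `T a = a(-2)𝟏`. -/
def T (a : V) : V := prod K (-2) a (vac K V)

/-- The operator `L(n) = ω(n+1)`. -/
def L (ω : V) (n : ℤ) : Module.End K V := prod K (n + 1) ω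

/-- The weight space `V_n = {v | L(0)v = nv}` of a vector `ω`. If `ω` is conformal, this is the
degree `n` part of the grading. -/
def wt (ω : V) (n : ℤ) : Submodule K V := Module.End.eigenspace (L K ω 0) (n : K)

/-- `ω` is a conformal vector, i.e. `(V, ω)` is a `ℤ`-graded conformal vertex algebra. The grading
is necessarily the one by the eigenspaces of `L(0)`. -/
structure IsConformal (ω : V) : Prop where
  internal : DirectSum.IsInternal (wt K ω)
  prod_mem : ∀ (n m k : ℤ) (a b : V), a ∈ wt K ω n → b ∈ wt K ω m →
    prod K k a b ∈ wt K ω (n + m - k - 1)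
  vac_mem : vac K V ∈ wt K ω 0
  self_mem : ω ∈ wt K ω 2
  virasoro : ∃ c : K, ∀ (n m : ℤ) (v : V),
    L K ω n (L K ω m v) - L K ω m (L K ω n v) =
      ((n - m : ℤ) : K) • L K ω (n + m) v +
        (if n + m = 0 then (1 / 12 : K) * ((n ^ 3 - n : ℤ) : K) * c else 0) • v
  translation : ∀ v : V, L K ω (-1) v = T K v

/-- `(V, ω)` is a VOA of CFT type. -/
structure IsCFTType (ω : V) : Prop extends IsConformal K ω where
  wt_neg : ∀ n : ℤ, n < 0 → wt K ω n = ⊥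
  finite : ∀ n : ℤ, Module.Finite K (wt K ω n)
  wt_zero : wt K ω 0 = Submodule.span K {vac K V}

/-- `(V, ω)` is a VOA of strong CFT type. -/
structure IsStrongCFTType (ω : V) : Prop extends IsCFTType K ω where
  L_one : ∀ v ∈ wt K ω 1, L K ω 1 v = 0

/-- `J₁(V) = {a ∈ V₁ | a(0) = 0}`. -/
def J₁ (ω : V) : Submodule K V := wt K ω 1 ⊓ LinearMap.ker (prod K 0)

variable (V) in
/-- The group `Aut V` of vertex algebra automorphisms. -/
def Aut : Subgroup (V ≃ₗ[K] V) where
  carrier := {f | f (vac K V) = vac K V ∧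
    ∀ (n : ℤ) (a b : V), f (prod K n a b) = prod K n (f a) (f b)}
  one_mem' := ⟨rfl, fun _ _ _ => rfl⟩
  mul_mem' := by
    rintro f g ⟨hf, hf'⟩ ⟨hg, hg'⟩
    exact ⟨by simp [hf, hg], fun n a b => by simp [hf', hg']⟩
  inv_mem' := by
    rintro f ⟨hf, hf'⟩
    refine ⟨f.injective ?_, fun n a b => f.injective ?_⟩
    · rw [hf]; exact f.apply_symm_apply _
    · rw [hf']
      exact (f.apply_symm_apply _).trans (by
        congr 1
        · congr 1; exact (f.apply_symm_apply a).symm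
        · exact (f.apply_symm_apply b).symm)

/-- `Aut_ω V`, the automorphisms of `V` that fix `ω`. -/
def AutOmega (ω : V) : Subgroup (Aut K V) where
  carrier := {f | f.1 ω = ω}
  one_mem' := rfl
  mul_mem' := by
    intro f g hf hg
    change f.1 (g.1 ω) = ω
    rw [show g.1 ω = ω from hg, show f.1 ω = ω from hf]
  inv_mem' := by
    intro f hf
    exact f.1.injective ((f.1.apply_symm_apply ω).trans (show f.1 ω = ω from hf).symm)

variable {K}

/-- The sum of the `V_k` with `k < n`. -/
def wtLT (K : Type*) {V : Type*} [Field K] [AddCommGroup V] [Module K V] [VertexAlgebra K V]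
    (ω : V) (n : ℤ) : Submodule K V := ⨆ k : ℤ, ⨆ _ : k < n, wt K ω k

theorem wtLT_mono (ω : V) {m n : ℤ} (h : m ≤ n) : wtLT K ω m ≤ wtLT K ω n :=
  iSup₂_le fun k hk => le_iSup₂_of_le (f := fun k (_ : k < n) => wt K ω k) k (by omega) le_rfl

theorem wt_le_wtLT (ω : V) {m n : ℤ} (h : m < n) : wt K ω m ≤ wtLT K ω n :=
  le_iSup₂_of_le (f := fun k (_ : k < n) => wt K ω k) m h le_rfl

theorem IsConformal.exists_mem_wtLT {ω : V} (hω : IsConformal K ω) (v : V) :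
    ∃ n : ℤ, v ∈ wtLT K ω n := by
  have hv : v ∈ ⨆ n, wt K ω n := by rw [hω.internal.submodule_iSup_eq_top]; trivial
  induction hv using Submodule.iSup_induction' with
  | mem n x hx => exact ⟨n + 1, wt_le_wtLT ω (by omega) hx⟩
  | zero => exact ⟨0, Submodule.zero_mem _⟩
  | add x y _ _ hx hy =>
    obtain ⟨m, hm⟩ := hx
    obtain ⟨n, hn⟩ := hy
    exact ⟨max m n, Submodule.add_mem _ (wtLT_mono ω (le_max_left _ _) hm)
      (wtLT_mono ω (le_max_right _ _) hn)⟩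

theorem sub_mem_wtLT {ω : V} {f : V →ₗ[K] V}
    (hf : ∀ n : ℤ, ∀ v ∈ wt K ω n, f v - v ∈ wtLT K ω n) (n : ℤ) (v : V)
    (hv : v ∈ wtLT K ω (n + 1)) : f v - v ∈ wtLT K ω n := by
  have : wtLT K ω (n + 1) ≤ (wtLT K ω n).comap (f - LinearMap.id) :=
    iSup₂_le fun k hk x hx => wtLT_mono ω (by omega : k ≤ n) (hf k x hx)
  exact this hv

/-- `Aut⁻ V`: the automorphisms `f` such that, for every `n` and every `v ∈ V_n`, the vector `f v`
lies in `⨁_{k ≤ n} V_k` and has degree `n` component `v`; that is, `f v - v ∈ ⨁_{k < n} V_k`. -/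
def AutMinus {ω : V} (hω : IsConformal K ω) : Subgroup (Aut K V) where
  carrier := {f | ∀ n : ℤ, ∀ v ∈ wt K ω n, f.1 v - v ∈ wtLT K ω n}
  one_mem' := by
    intro n v _
    change v - v ∈ _
    rw [sub_self]
    exact Submodule.zero_mem _
  mul_mem' := by
    intro f g hf hg n v hv
    change f.1 (g.1 v) - v ∈ _
    have h2 : g.1 v - v ∈ wtLT K ω n := hg n v hv
    have h3 : g.1 v ∈ wtLT K ω (n + 1) := by
      have := Submodule.add_mem _ (wtLT_mono ω (by omega : n ≤ n + 1) h2)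
        (wt_le_wtLT ω (by omega : n < n + 1) hv)
      simpa using this
    have h4 := sub_mem_wtLT (f := f.1.toLinearMap) hf n _ h3
    have := Submodule.add_mem _ h4 h2
    simpa using this
  inv_mem' := by
    intro f hf n v hv
    change f.1.symm v - v ∈ _
    set w := f.1.symm v with hw
    have hfw : f.1 w = v := f.1.apply_symm_apply v
    have step : ∀ m : ℕ, w ∈ wtLT K ω (n + 1 + m) → w ∈ wtLT K ω (n + 1) := by
      intro m
      induction m with
      | zero => intro h; simpa using h
      | succ m ih =>
        intro h
        apply ih
        have h1 := sub_mem_wtLT (f := f.1.toLinearMap) hf (n + 1 + m) w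
          (by convert h using 2; push_cast; ring)
        have h2 : v ∈ wtLT K ω (n + 1 + m) := wt_le_wtLT ω (by omega) hv
        have := Submodule.sub_mem _ h2 h1
        simpa [hfw] using this
    obtain ⟨M, hM⟩ := hω.exists_mem_wtLT w
    have hw1 : w ∈ wtLT K ω (n + 1) :=
      step (M - (n + 1)).toNat (wtLT_mono ω (by omega) hM)
    have := Submodule.neg_mem _ (sub_mem_wtLT (f := f.1.toLinearMap) hf n w hw1)
    simpa [hfw] using this

end General

section Unitary

variable {V : Type*} [AddCommGroup V] [Module ℂ V] [VertexAlgebra ℂ V]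

/-- An anti-involution of `(V, ω)`: an antilinear automorphism of the VOA with square `1`. -/
structure AntiInvolution (ω : V) where
  /-- The underlying antilinear map. -/
  toFun : V →ₛₗ[starRingEnd ℂ] V
  involutive : ∀ v, toFun (toFun v) = v
  map_vac : toFun (vac ℂ V) = vac ℂ V
  map_omega : toFun ω = ω
  map_prod : ∀ (n : ℤ) (a b : V), toFun (prod ℂ n a b) = prod ℂ n (toFun a) (toFun b)

namespace AntiInvolution

variable {ω : V} (σ : AntiInvolution ω)

/-- `(V, ω)` is unitary with anti-involution `σ`: there is a positive-definite Hermitian form,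
linear in the first variable, that is invariant in the sense
`(Y(e^{zL(1)}(-z⁻²)^{L(0)}a, z⁻¹)u, v) = (u, Y(σ(a), z)v)`.
For `a ∈ V_n`, the coefficient of `z^{-k-1}` gives the last clause. Its sum is finite when the
weights are bounded below. -/
def IsUnitary : Prop :=
  ∃ h : V →ₗ[ℂ] V →ₛₗ[starRingEnd ℂ] ℂ,
    (∀ u v, h u v = conj (h v u)) ∧
    (∀ v, v ≠ 0 → 0 < (h v v).re) ∧
    ∀ (n k : ℤ) (a u v : V), a ∈ wt ℂ ω n →
      n.negOnePow • ∑ᶠ j : ℕ, ((j.factorial : ℂ)⁻¹ *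
        h (prod ℂ (2 * n - k - j - 2) (((L ℂ ω 1) ^ j) a) u) v) =
      h u (prod ℂ k (σ.toFun a) v)

/-- The real form `V^σ = {v | σ(v) = v}`, a real subspace of `V`. -/
def realForm : Submodule ℝ V where
  carrier := {v | σ.toFun v = v}
  add_mem' := by
    intro a b ha hb
    change σ.toFun (a + b) = a + b
    rw [map_add, show σ.toFun a = a from ha, show σ.toFun b = b from hb]
  zero_mem' := map_zero _
  smul_mem' := by
    intro r a ha
    change σ.toFun ((r : ℂ) • a) = (r : ℂ) • a
    rw [LinearMap.map_smulₛₗ, show σ.toFun a = a from ha, Complex.conj_ofReal]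

theorem prod_mem_realForm (n : ℤ) (a b : σ.realForm) :
    prod ℂ n (a : V) (b : V) ∈ σ.realForm := by
  change σ.toFun _ = _
  rw [σ.map_prod, show σ.toFun a = a from a.2, show σ.toFun b = b from b.2]

/-- `V^σ` is a vertex algebra over `ℝ` with the products and the vacuum of `V`. -/
noncomputable instance : VertexAlgebra ℝ σ.realForm where
  prod n := LinearMap.mk₂ ℝ (fun a b => ⟨prod ℂ n (a : V) (b : V), σ.prod_mem_realForm n a b⟩)
    (fun a b c => Subtype.ext (by simp))
    (fun r a b => Subtype.ext (by
      change prod ℂ n ((r : ℂ) • (a : V)) (b : V) = (r : ℂ) • prod ℂ n (a : V) (b : V)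
      simp))
    (fun a b c => Subtype.ext (by simp))
    (fun r a b => Subtype.ext (by
      change prod ℂ n (a : V) ((r : ℂ) • (b : V)) = (r : ℂ) • prod ℂ n (a : V) (b : V)
      simp))
  vac := ⟨vac ℂ V, σ.map_vac⟩
  truncation a b := by
    obtain ⟨N, hN⟩ := truncation (K := ℂ) (a : V) (b : V)
    exact ⟨N, fun n hn => Subtype.ext (hN n hn)⟩
  vac_prod n a := Subtype.ext (by
    refine (vac_prod (K := ℂ) n (a : V)).trans ?_
    split_ifs <;> rfl)
  prod_vac_of_nonneg n a hn := Subtype.ext (prod_vac_of_nonneg (K := ℂ) n (a : V) hn)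
  prod_vac_neg_one a := Subtype.ext (prod_vac_neg_one (K := ℂ) (a : V))
  borcherds p q r a b c := by
    apply Subtype.ext
    have key := borcherds (K := ℂ) p q r (a : V) (b : V) (c : V)
    have hinj : Function.Injective σ.realForm.subtype.toAddMonoidHom := Subtype.val_injective
    refine (AddMonoidHom.map_finsum_of_injective _ hinj _).trans
      (Eq.trans ?_ (AddMonoidHom.map_finsum_of_injective _ hinj _).symm)
    exact key

@[simp]
theorem coe_prod (n : ℤ) (a b : σ.realForm) :
    ((prod ℝ n a b : σ.realForm) : V) = prod ℂ n (a : V) (b : V) := rfl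

/-- The vector `ω`, as an element of `V^σ`. -/
def omega : σ.realForm := ⟨ω, σ.map_omega⟩

theorem coe_L (n : ℤ) (a : σ.realForm) :
    ((L ℝ σ.omega n a : σ.realForm) : V) = L ℂ ω n (a : V) := rfl

theorem mem_wt_iff (n : ℤ) (a : σ.realForm) :
    a ∈ wt ℝ σ.omega n ↔ (a : V) ∈ wt ℂ ω n := by
  rw [wt, wt, Module.End.mem_eigenspace_iff, Module.End.mem_eigenspace_iff, ← Subtype.coe_inj,
    coe_L]
  have : (((n : ℝ) • a : σ.realForm) : V) = (n : ℂ) • (a : V) := by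
    change ((n : ℝ) : ℂ) • (a : V) = _
    rw [Complex.ofReal_intCast]
  rw [this]

theorem map_mem_wt {n : ℤ} {x : V} (hx : x ∈ wt ℂ ω n) : σ.toFun x ∈ wt ℂ ω n := by
  rw [wt, Module.End.mem_eigenspace_iff] at hx ⊢
  have h := congrArg σ.toFun hx
  rw [L, σ.map_prod, σ.map_omega, LinearMap.map_smulₛₗ, map_intCast] at h
  exact h

/-- `ω` is a conformal vector of `V^σ`. -/
theorem isConformal_omega (hω : IsConformal ℂ ω) : IsConformal ℝ σ.omega where
  internal := by
    apply DirectSum.isInternal_submodule_of_iSupIndep_of_iSup_eq_top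
    · exact (Module.End.eigenspaces_iSupIndep (L ℝ σ.omega 0)).comp
        (f := fun n : ℤ => (n : ℝ)) Int.cast_injective
    · rw [eq_top_iff]
      intro x _
      have hx : (x : V) ∈ ⨆ n, wt ℂ ω n := by rw [hω.internal.submodule_iSup_eq_top]; trivial
      obtain ⟨f, hf, hfx⟩ := (Submodule.mem_iSup_iff_exists_finsupp _ _).1 hx
      have hy : ∀ n, (2⁻¹ : ℂ) • (f n + σ.toFun (f n)) ∈ σ.realForm := by
        intro n
        change σ.toFun _ = _
        rw [LinearMap.map_smulₛₗ, map_add, σ.involutive, add_comm, map_inv₀, map_ofNat]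
      have hxs : x = ∑ n ∈ f.support, ⟨(2⁻¹ : ℂ) • (f n + σ.toFun (f n)), hy n⟩ := by
        apply Subtype.ext
        rw [Submodule.coe_sum]
        simp only
        rw [← Finset.smul_sum, Finset.sum_add_distrib,
          ← map_sum σ.toFun (fun n => f n)]
        have : ∑ n ∈ f.support, f n = (x : V) := hfx
        rw [this, show σ.toFun x = x from x.2, ← two_smul ℂ (x : V), smul_smul]
        norm_num
      rw [hxs]
      refine Submodule.sum_mem _ fun n _ => Submodule.mem_iSup_of_mem n ?_
      rw [mem_wt_iff]
      exact Submodule.smul_mem _ _ (Submodule.add_mem _ (hf n) (σ.map_mem_wt (hf n)))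
  prod_mem n m k a b ha hb := by
    rw [mem_wt_iff] at *
    exact hω.prod_mem n m k a b ha hb
  vac_mem := by rw [mem_wt_iff]; exact hω.vac_mem
  self_mem := by rw [mem_wt_iff]; exact hω.self_mem
  virasoro := by
    obtain ⟨c, hc⟩ := hω.virasoro
    have hre : ∀ v : σ.realForm, c • (v : V) = (c.re : ℂ) • (v : V) := by
      intro v
      have h0 := hc 2 (-2) v
      norm_num at h0
      have h1 : (2⁻¹ * c) • (v : V) =
          ((L ℝ σ.omega 2 (L ℝ σ.omega (-2) v) - L ℝ σ.omega (-2) (L ℝ σ.omega 2 v)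
            - (4 : ℝ) • L ℝ σ.omega 0 v : σ.realForm) : V) := by
        change _ = L ℂ ω 2 (L ℂ ω (-2) v) - L ℂ ω (-2) (L ℂ ω 2 v)
          - ((4 : ℝ) : ℂ) • L ℂ ω 0 v
        rw [h0]
        norm_num
      have h2 : σ.toFun ((2⁻¹ * c) • (v : V)) = (2⁻¹ * c) • (v : V) := by
        rw [h1]
        exact (L ℝ σ.omega 2 (L ℝ σ.omega (-2) v) - L ℝ σ.omega (-2) (L ℝ σ.omega 2 v)
            - (4 : ℝ) • L ℝ σ.omega 0 v : σ.realForm).2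
      rw [LinearMap.map_smulₛₗ, show σ.toFun v = v from v.2] at h2
      have h3 : (c.re : ℂ) = 2⁻¹ * c + conj (2⁻¹ * c) := by
        apply Complex.ext
        · simp
          ring
        · simp
      rw [h3, add_smul, h2, ← add_smul]
      congr 1; ring
    refine ⟨c.re, fun n m v => Subtype.ext ?_⟩
    have h := hc n m v
    change L ℂ ω n (L ℂ ω m v) - L ℂ ω m (L ℂ ω n v) =
      (((n - m : ℤ) : ℝ) : ℂ) • L ℂ ω (n + m) v + ((_ : ℝ) : ℂ) • (v : V)
    rw [h]
    rw [Complex.ofReal_intCast]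
    congr 1
    split_ifs
    · rw [mul_smul, hre, ← mul_smul]
      push_cast
      rfl
    · simp
  translation v := Subtype.ext (hω.translation v)

end AntiInvolution

end Unitary

end VertexAlgebra

/-! The whole theorem rests on one fact: every automorphism `f` of V^σ satisfies f(ω) ≡ ω modulo
weights below 2 (`map_omega_sub_mem_wtLT`). Given this, f(ω)(1) agrees with L(0) to leading order,
so `f` respects the weight filtration (`map_mem_wtLT_of_sub_mem`). Its degree-preserving part gr(f)
is then an automorphism fixing ω, and f = (f gr(f)⁻¹) gr(f) is the required factorization
(`exists_mul_eq`).

The fact comes from positivity: if u ≠ 0 has weight m > 0, then (-1)^m (u(2m-1)σ(u), 𝟏) > 0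
(`prod_conj_pos`), so u(2m-1)u ≠ 0 when σ(u) = u. Let u be the top component of f(ω), of weight m >
2. The weight 0 part of f(ω)(2m-1)f(ω) is u(2m-1)u, while the product itself is f(ω(2m-1)ω) = 0 for
weight reasons; hence u = 0. In weight 2 write u = ω + d. Since f(ω)(0) = T, leading terms give
d(0)ω = 0, which forces d ∈ T V₁ (`exists_eq_T`). Then ω(3)d = d(3)ω = 0, and invariance of ω(3)ω
leaves d(3)d = 0, so d = 0.

If J₁(V) = 0, then f(ω) = ω + u + z with u of weight 1 and z of weight 0. The identity f(ω)(0) = T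
puts u in J₁(V), and f(ω)(1)f(ω) = 2f(ω) kills z. -/

namespace VertexAlgebra

/-! ### Consequences of the Borcherds identity -/

section Products

variable {K V : Type*} [Field K] [AddCommGroup V] [Module K V] [VertexAlgebra K V]

theorem commutator_formula (p q : ℤ) (a b c : V) :
    prod K p a (prod K q b c) - prod K q b (prod K p a c) =
      ∑ᶠ i : ℕ, Ring.choose p i • prod K (p + q - i) (prod K i a b) c := by
  have h := borcherds (K := K) p q 0 a b c
  rw [finsum_eq_single (fun i : ℕ => ((-1) ^ i * Ring.choose (0 : ℤ) i) • _) 0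
    (fun i hi => by rw [Ring.choose_zero_pos ℤ (Nat.pos_of_ne_zero hi)]; simp)] at h
  simpa using h.symm

theorem prod_zero_prod (q : ℤ) (a b c : V) :
    prod K 0 a (prod K q b c) = prod K q (prod K 0 a b) c + prod K q b (prod K 0 a c) := by
  have h := commutator_formula (K := K) 0 q a b c
  rw [finsum_eq_single _ 0
    (fun i hi => by rw [Ring.choose_zero_pos ℤ (Nat.pos_of_ne_zero hi)]; simp)] at h
  simp at h
  rw [← h]; abel

theorem prod_one_prod (q : ℤ) (a b c : V) :
    prod K 1 a (prod K q b c) = prod K (q + 1) (prod K 0 a b) c + prod K q (prod K 1 a b) c +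
      prod K q b (prod K 1 a c) := by
  have h := commutator_formula (K := K) 1 q a b c
  rw [finsum_eq_sum_of_support_subset (s := Finset.range 2) _ (by
    intro i hi
    by_contra hi2
    apply hi
    have h2 : 1 < i := by simpa using hi2
    have := Ring.choose_natCast (R := ℤ) 1 i
    rw [Nat.choose_eq_zero_of_lt h2] at this
    simp only [Nat.cast_one, Nat.cast_zero] at this
    simp [this])] at h
  simp only [Finset.sum_range_succ, Finset.sum_range_zero, Ring.choose_zero_right,
    Ring.choose_one_right, Nat.cast_zero, Nat.cast_one, one_smul, zero_add, sub_zero,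
    add_sub_cancel_left] at h
  rw [add_comm q 1, ← h]; abel

/-- The Borcherds identity with p = -1, q = 0 and c = 𝟏: on the right the vacuum annihilates every
term with i > 0, and on the left the binomials of -1 are signs. -/
theorem skew_symmetry (r : ℤ) (a b : V) :
    ∑ᶠ i : ℕ, (-1 : ℤ) ^ i • prod K (-1 - i) (prod K (r + i) a b) (vac K V) =
      -(r.negOnePow • prod K r b a) := by
  have h := borcherds (K := K) (-1) 0 r a b (vac K V)
  rw [finsum_eq_single (fun i : ℕ => ((-1) ^ i * Ring.choose (r : ℤ) i) • _) 0
    (fun i hi => by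
      rw [prod_vac_of_nonneg _ _ (by omega), prod_vac_of_nonneg _ _ (by omega)]
      simp)] at h
  simp only [Ring.choose_neg] at h
  have hc : ∀ i : ℕ, Ring.choose (1 + (i : ℤ) - 1) i = 1 := fun i => by
    rw [add_sub_cancel_left, Ring.choose_natCast]; simp
  simp only [hc] at h
  rw [prod_vac_of_nonneg _ _ (by simp)] at h
  simp only [Nat.cast_zero, add_zero, sub_zero, prod_vac_neg_one, map_zero, zero_sub, pow_zero,
    Ring.choose_zero_right, one_mul, one_smul, zero_add] at h
  rw [← h]
  refine finsum_congr fun i => ?_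
  congr 1
  rw [Units.smul_def, Int.coe_negOnePow_natCast]
  simp

end Products

/-! ### Weights, the filtration and Virasoro relations -/

section Filtration

variable {K V : Type*} [Field K] [AddCommGroup V] [Module K V] [VertexAlgebra K V] {ω : V}

theorem mem_wt {n : ℤ} {v : V} : v ∈ wt K ω n ↔ prod K 1 ω v = (n : K) • v :=
  Module.End.mem_eigenspace_iff

theorem wtLT_le {n : ℤ} {S : Submodule K V} (h : ∀ k < n, wt K ω k ≤ S) : wtLT K ω n ≤ S :=
  iSup₂_le h

theorem exists_add_of_mem_wtLT {n : ℤ} {x : V} (hx : x ∈ wtLT K ω (n + 1)) :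
    ∃ u ∈ wt K ω n, ∃ y ∈ wtLT K ω n, u + y = x := by
  rw [← Submodule.mem_sup]
  refine wtLT_le (fun k hk => ?_) hx
  rcases (Int.lt_add_one_iff.1 hk).lt_or_eq with h | rfl
  · exact (wt_le_wtLT ω h).trans le_sup_right
  · exact le_sup_left

theorem wtLT_zero_eq_bot (h : ∀ n < 0, wt K ω n = ⊥) : wtLT K ω 0 = ⊥ :=
  le_bot_iff.1 (wtLT_le fun k hk => (h k hk).le)

theorem vac_prod_nonneg {n : ℤ} (hn : 0 ≤ n) (a : V) : prod K n (vac K V) a = 0 := by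
  rw [vac_prod, if_neg (by omega)]

theorem L_vac {n : ℤ} (hn : -1 ≤ n) : L K ω n (vac K V) = 0 :=
  prod_vac_of_nonneg _ _ (by omega)

theorem L_neg_two_vac : L K ω (-2) (vac K V) = ω := prod_vac_neg_one ω

namespace IsConformal

theorem eq_zero_of_mem (hω : IsConformal K ω) {n : ℤ} {x : V} (h : x ∈ wt K ω n)
    (h' : x ∈ wtLT K ω n) : x = 0 :=
  Submodule.disjoint_def.1 (hω.internal.submodule_iSupIndep n) x h
    (wtLT_le (fun k hk => le_iSup₂_of_le (f := fun k (_ : k ≠ n) => wt K ω k) k hk.ne le_rfl) h')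

/-- The factors have weights at most n - 1 and m - 1, so the product has weights at most n + m - k -
3; this explains the 2 in the bound. -/
theorem prod_mem_wtLT (hω : IsConformal K ω) {n m l k : ℤ} (hl : n + m - k - 2 ≤ l) {a b : V}
    (ha : a ∈ wtLT K ω n) (hb : b ∈ wtLT K ω m) : prod K k a b ∈ wtLT K ω l := by
  have key : ∀ i < n, ∀ a ∈ wt K ω i, wtLT K ω m ≤ (wtLT K ω l).comap (prod K k a) :=
    fun i hi a ha => wtLT_le fun j hj b hb =>
      wt_le_wtLT ω (by omega) (hω.prod_mem i j k a b ha hb)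
  have : wtLT K ω n ≤ (wtLT K ω l).comap ((prod K k).flip b) :=
    wtLT_le fun i hi a ha => key i hi a ha hb
  exact this ha

theorem linearMap_ext (hω : IsConformal K ω) {W : Type*} [AddCommGroup W] [Module K W]
    {f g : V →ₗ[K] W} (h : ∀ n, ∀ v ∈ wt K ω n, f v = g v) : f = g := by
  have : (⨆ n, wt K ω n) ≤ LinearMap.eqLocus f g := iSup_le fun n v hv => h n v hv
  rw [hω.internal.submodule_iSup_eq_top] at this
  exact LinearMap.ext fun v => this trivial

theorem prod_zero (hω : IsConformal K ω) (v : V) : prod K 0 ω v = T K v := hω.translation v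

theorem T_prod (hω : IsConformal K ω) (q : ℤ) (b c : V) :
    T K (prod K q b c) = prod K q (T K b) c + prod K q b (T K c) := by
  simpa only [hω.prod_zero] using prod_zero_prod (K := K) q ω b c

theorem T_mem (hω : IsConformal K ω) {n : ℤ} {v : V} (hv : v ∈ wt K ω n) :
    T K v ∈ wt K ω (n + 1) := by
  rw [← hω.prod_zero]
  convert hω.prod_mem 2 n 0 ω v hω.self_mem hv using 2
  ring

/-- Expand L(0) = ω(1) on b(q-1)c: besides the weights of b and c there is only the term (Tb)(q)c,
so it accounts for the weight discrepancy -q. -/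
theorem prod_T (hω : IsConformal K ω) {n m : ℤ} {b c : V} (hb : b ∈ wt K ω n)
    (hc : c ∈ wt K ω m) (q : ℤ) :
    prod K q (T K b) c = -((q : K) • prod K (q - 1) b c) := by
  have h := prod_one_prod (K := K) (q - 1) ω b c
  rw [mem_wt.1 (hω.prod_mem n m (q - 1) b c hb hc), hω.prod_zero, mem_wt.1 hb, mem_wt.1 hc,
    sub_add_cancel, map_smul, map_smul, LinearMap.smul_apply] at h
  rw [add_assoc, ← add_smul, ← sub_eq_iff_eq_add, ← sub_smul] at h
  rw [← h, ← neg_smul]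
  congr 1
  push_cast; ring

theorem L_mem (hω : IsConformal K ω) {n m k : ℤ} (hk : n - m = k) {v : V} (hv : v ∈ wt K ω n) :
    L K ω m v ∈ wt K ω k := by
  have h := hω.prod_mem 2 n (m + 1) ω v hω.self_mem hv
  rwa [show 2 + n - (m + 1) - 1 = k by omega] at h

/-- As ω = L(-2)𝟏, this is [L(1), L(-2)]𝟏 = 3L(-1)𝟏 = 0. It makes ω quasi-primary, so invariance
yields the adjoint of L(1). -/
theorem L_one_self (hω : IsConformal K ω) : L K ω 1 ω = 0 := by
  obtain ⟨c, hc⟩ := hω.virasoro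
  have h := hc 1 (-2) (vac K V)
  rw [L_neg_two_vac, L_vac (ω := ω) (n := 1) (by norm_num)] at h
  have h2 : (1 : ℤ) + -2 = -1 := by norm_num
  rw [h2, L_vac (ω := ω) (n := -1) le_rfl] at h
  simpa using h

theorem L_T (hω : IsConformal K ω) {n : ℤ} (hn : 1 < n) (v : V) :
    L K ω n (T K v) = T K (L K ω n v) + ((n + 1 : ℤ) : K) • L K ω (n - 1) v := by
  obtain ⟨c, hc⟩ := hω.virasoro
  have h := hc n (-1) v
  rw [hω.translation, hω.translation, if_neg (by omega), zero_smul, add_zero,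
    sub_eq_iff_eq_add'] at h
  rw [h]; congr 2

theorem L_one_T (hω : IsConformal K ω) {n : ℤ} {v : V} (hv : v ∈ wt K ω n) :
    L K ω 1 (T K v) = T K (L K ω 1 v) + ((2 * n : ℤ) : K) • v := by
  obtain ⟨c, hc⟩ := hω.virasoro
  have h := hc 1 (-1) v
  rw [hω.translation, hω.translation, sub_eq_iff_eq_add', show (1 : ℤ) + -1 = 0 by norm_num,
    show L K ω 0 v = (n : K) • v from mem_wt.1 hv] at h
  rw [h, smul_smul]
  norm_num

end IsConformal

namespace IsCFTType

theorem eq_zero_of_neg (hω : IsCFTType K ω) {n : ℤ} (hn : n < 0) {v : V} (hv : v ∈ wt K ω n) :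
    v = 0 := by
  rw [hω.wt_neg n hn] at hv; exact hv

end IsCFTType

/-- Skew-symmetry for products that land in degree zero. -/
theorem IsConformal.prod_comm_of_degree_zero (hω : IsConformal K ω)
    (hneg : ∀ n < 0, wt K ω n = ⊥) {n m r : ℤ}
    (hr : n + m - r - 1 = 0) {a b : V} (ha : a ∈ wt K ω n) (hb : b ∈ wt K ω m) :
    prod K r a b = -(r.negOnePow • prod K r b a) := by
  rw [← skew_symmetry, finsum_eq_single _ 0]
  · simp [prod_vac_neg_one]
  · intro i hi
    have h := hω.prod_mem n m (r + i) a b ha hb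
    rw [hneg _ (by omega), Submodule.mem_bot] at h
    rw [h]; simp

end Filtration

/-! ### Invariant forms and positivity of the contraction to the vacuum -/

namespace AntiInvolution

variable {V : Type*} [AddCommGroup V] [Module ℂ V] [VertexAlgebra ℂ V] {ω : V}

/-- A positive-definite invariant Hermitian form, as in the definition of unitarity. -/
structure IsInvariantForm (σ : AntiInvolution ω) (h : V →ₗ[ℂ] V →ₛₗ[starRingEnd ℂ] ℂ) :
    Prop where
  symm : ∀ u v, h u v = conj (h v u)
  pos : ∀ v, v ≠ 0 → 0 < (h v v).re
  invariant : ∀ (n k : ℤ) (a u v : V), a ∈ wt ℂ ω n →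
      n.negOnePow • ∑ᶠ j : ℕ, ((j.factorial : ℂ)⁻¹ *
        h (prod ℂ (2 * n - k - j - 2) (((L ℂ ω 1) ^ j) a) u) v) =
      h u (prod ℂ k (σ.toFun a) v)

theorem map_L (σ : AntiInvolution ω) (n : ℤ) (v : V) :
    σ.toFun (L ℂ ω n v) = L ℂ ω n (σ.toFun v) := by
  rw [L, σ.map_prod, σ.map_omega]

theorem map_T (σ : AntiInvolution ω) (v : V) :
    σ.toFun (T ℂ v) = T ℂ (σ.toFun v) := by
  rw [T, σ.map_prod, σ.map_vac]; rfl

theorem map_ne_zero (σ : AntiInvolution ω) {v : V} (hv : v ≠ 0) : σ.toFun v ≠ 0 := by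
  intro h
  rw [← σ.involutive v, h, map_zero] at hv
  exact hv rfl

namespace IsInvariantForm

variable {σ : AntiInvolution ω} {h : V →ₗ[ℂ] V →ₛₗ[starRingEnd ℂ] ℂ}

theorem eq_zero (hh : σ.IsInvariantForm h) {v : V} (hv : h v v = 0) : v = 0 := by
  by_contra hne
  have := hh.pos v hne
  rw [hv] at this
  exact lt_irrefl _ this

theorem nonneg (hh : σ.IsInvariantForm h) (v : V) : 0 ≤ (h v v).re := by
  by_cases hv : v = 0
  · simp [hv]
  · exact (hh.pos v hv).le

/-- Invariance for quasi-primary vectors. -/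
theorem invariant_of_L_one_eq_zero (hh : σ.IsInvariantForm h) {n k l : ℤ} {a : V}
    (ha : a ∈ wt ℂ ω n) (hL : L ℂ ω 1 a = 0) (hl : 2 * n - k - 2 = l) (u v : V) :
    n.negOnePow • h (prod ℂ l a u) v = h u (prod ℂ k (σ.toFun a) v) := by
  rw [← hh.invariant n k a u v ha, finsum_eq_single _ 0]
  · simp [hl]
  · intro j hj
    obtain ⟨i, rfl⟩ := Nat.exists_eq_succ_of_ne_zero hj
    rw [pow_succ, Module.End.mul_apply, hL]
    simp

theorem L_one_adjoint (hh : σ.IsInvariantForm h) (hω : IsConformal ℂ ω) (u v : V) :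
    h (L ℂ ω 1 u) v = h u (T ℂ v) := by
  have := hh.invariant_of_L_one_eq_zero hω.self_mem hω.L_one_self (k := 0) (l := 2)
    (by norm_num) u v
  rw [σ.map_omega, hω.prod_zero, show (2 : ℤ).negOnePow = 1 from rfl, one_smul] at this
  exact this

/-- The adjoint of L(1) is T and [L(1), T] = 2L(0), so (L(1)Tw, w) = ‖L(1)w‖² + 2n‖w‖². -/
theorem eq_zero_of_L_one_T (hh : σ.IsInvariantForm h) (hω : IsConformal ℂ ω) {n : ℤ}
    (hn : 0 < n) {w : V} (hw : w ∈ wt ℂ ω n) (h0 : L ℂ ω 1 (T ℂ w) = 0) : w = 0 := by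
  by_contra hne
  have h1 : h (L ℂ ω 1 (T ℂ w)) w = conj (h (L ℂ ω 1 w) (L ℂ ω 1 w)) + (2 * n) * h w w := by
    rw [hω.L_one_T hw, map_add, LinearMap.add_apply, hh.symm (T ℂ _), ← hh.L_one_adjoint hω,
      map_smul, LinearMap.smul_apply]
    push_cast; rfl
  rw [h0] at h1
  have h2 := congrArg Complex.re h1
  have h3 := hh.pos w hne
  have h4 := hh.nonneg (L ℂ ω 1 w)
  have h5 : ((2 * (n : ℂ)) * h w w).re = 2 * n * (h w w).re := by
    rw [show (2 * (n : ℂ)) = ((2 * n : ℝ) : ℂ) by push_cast; rfl, Complex.re_ofReal_mul]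
  rw [Complex.add_re, Complex.conj_re, h5] at h2
  simp only [map_zero, LinearMap.zero_apply, Complex.zero_re] at h2
  have h6 : (0 : ℝ) < n := by exact_mod_cast hn
  have h7 : 0 < 2 * n * (h w w).re := by positivity
  linarith

/-- In positive weight, every vector is quasi-primary up to the image of `T`. -/
theorem exists_L_one_sub_T (hh : σ.IsInvariantForm h) (hω : IsCFTType ℂ ω) {n : ℤ}
    (hn : 0 < n) {u : V} (hu : u ∈ wt ℂ ω (n + 1)) :
    ∃ w ∈ wt ℂ ω n, L ℂ ω 1 (u - T ℂ w) = 0 := by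
  have := hω.finite n
  have hT : ∀ w ∈ wt ℂ ω n, (L ℂ ω 1 ∘ₗ L ℂ ω (-1)) w ∈ wt ℂ ω n := fun w hw =>
    hω.L_mem (n := n + 1) (by omega) (hω.L_mem (by omega) hw)
  -- L(1)T is injective on the finite-dimensional V_n, hence onto, so L(1)u = L(1)Tw has a solution
  -- w.
  have hinj : Function.Injective ((L ℂ ω 1 ∘ₗ L ℂ ω (-1)).restrict hT) := by
    rw [injective_iff_map_eq_zero]
    rintro ⟨w, hw⟩ h0
    have h1 : L ℂ ω 1 (L ℂ ω (-1) w) = 0 := congrArg Subtype.val h0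
    rw [hω.translation] at h1
    exact Subtype.ext (hh.eq_zero_of_L_one_T hω.toIsConformal hn hw h1)
  obtain ⟨⟨w, hw⟩, hwu⟩ := LinearMap.injective_iff_surjective.1 hinj
    ⟨L ℂ ω 1 u, hω.L_mem (by omega) hu⟩
  have h1 : L ℂ ω 1 (L ℂ ω (-1) w) = L ℂ ω 1 u := congrArg Subtype.val hwu
  rw [hω.translation] at h1
  exact ⟨w, hw, by rw [map_sub, h1, sub_self]⟩

theorem quasiPrimary_pos (hh : σ.IsInvariantForm h) {m l : ℤ} {q : V}
    (hq : q ∈ wt ℂ ω m) (hL : L ℂ ω 1 q = 0) (hl : l = 2 * m - 1) :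
    m.negOnePow • h (prod ℂ l q (σ.toFun q)) (vac ℂ V) = h (σ.toFun q) (σ.toFun q) := by
  rw [hh.invariant_of_L_one_eq_zero hq hL (k := -1) (by omega), prod_vac_neg_one]

/-- Invariance moves q(2m-2) to σ(q)(0) acting on the vacuum, which vanishes. This kills the cross
terms in `prod_conj_pos`. -/
theorem quasiPrimary_prod (hh : σ.IsInvariantForm h) {m l : ℤ} {q : V}
    (hq : q ∈ wt ℂ ω m) (hL : L ℂ ω 1 q = 0) (hl : l = 2 * m - 2) (y : V) :
    h (prod ℂ l q y) (vac ℂ V) = 0 := by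
  have := hh.invariant_of_L_one_eq_zero hq hL (k := 0) (l := l) (by omega) y (vac ℂ V)
  rwa [prod_vac_of_nonneg _ _ le_rfl, map_zero, smul_eq_zero_iff_eq] at this

/-- Induction on the weight through u = q + Tw with q quasi-primary: q contributes ‖σ(q)‖², the
cross terms vanish, and Tw contributes a positive multiple of the value at w. In weight 1 strong CFT
type makes u itself quasi-primary. -/
theorem prod_conj_pos (hh : σ.IsInvariantForm h) (hω : IsStrongCFTType ℂ ω) (n : ℕ) :
    ∀ u ∈ wt ℂ ω (n + 1), u ≠ 0 →
      0 < (((n : ℤ) + 1).negOnePow •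
        h (prod ℂ (2 * n + 1) u (σ.toFun u)) (vac ℂ V)).re := by
  induction n with
  | zero =>
    intro u hu hne
    rw [hh.quasiPrimary_pos hu (hω.L_one u (by simpa using hu)) (by simp)]
    exact hh.pos _ (σ.map_ne_zero hne)
  | succ n ih =>
    intro u hu hne
    have hneg : ∀ {k : ℤ} {v : V}, v ∈ wt ℂ ω k → k < 0 → v = 0 := fun hv hk =>
      hω.eq_zero_of_neg hk hv
    obtain ⟨w, hw, hL⟩ := hh.exists_L_one_sub_T hω.toIsCFTType (n := n + 1) (by omega)
      (u := u) (by exact_mod_cast hu)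
    obtain ⟨q, hqdef⟩ : ∃ q, q = u - T ℂ w := ⟨_, rfl⟩
    rw [← hqdef] at hL
    have hu' : u = q + T ℂ w := by rw [hqdef]; abel
    have hc := hω.toIsConformal
    have hTw : T ℂ w ∈ wt ℂ ω (n + 2) := by
      convert hc.T_mem hw using 2; ring
    have hq : q ∈ wt ℂ ω (n + 2) := by
      rw [hqdef]
      refine Submodule.sub_mem _ ?_ hTw
      convert hu using 2; push_cast; ring
    have hσq := σ.map_mem_wt hq
    have hσw := σ.map_mem_wt hw
    have hLσ : L ℂ ω 1 (σ.toFun q) = 0 := by rw [← σ.map_L, hL, map_zero]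
    -- q(2n+3)σ(w) has weight -1, so it vanishes and T can be moved from one factor to the other.
    have e1 : h (prod ℂ (2 * n + 3) q (T ℂ (σ.toFun w))) (vac ℂ V) = 0 := by
      have h1 := hc.T_prod (2 * n + 3) q (σ.toFun w)
      rw [hneg (hc.prod_mem _ _ (2 * n + 3) _ _ hq hσw) (by omega), T, map_zero,
        LinearMap.zero_apply, hc.prod_T hq hσw, eq_comm, neg_add_eq_zero] at h1
      rw [← h1, map_smul, LinearMap.smul_apply, hh.quasiPrimary_prod hq hL (by ring), smul_zero]
    have e2 : h (prod ℂ (2 * n + 3) (T ℂ w) (σ.toFun q)) (vac ℂ V) = 0 := by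
      rw [hc.prod_T hw hσq, hc.prod_comm_of_degree_zero hω.wt_neg (by ring) hw hσq]
      simp only [map_neg, map_smul, LinearMap.neg_apply, LinearMap.smul_apply, Units.smul_def,
        map_zsmul]
      rw [hh.quasiPrimary_prod hσq hLσ (by ring)]
      simp
    have e3 : prod ℂ (2 * n + 3) (T ℂ w) (T ℂ (σ.toFun w)) =
        -(((2 * n + 3) * (2 * n + 2) : ℝ) : ℂ) • prod ℂ (2 * n + 1) w (σ.toFun w) := by
      have h1 := hc.T_prod (2 * n + 3 - 1) w (σ.toFun w)
      rw [hneg (hc.prod_mem _ _ (2 * n + 3 - 1) _ _ hw hσw) (by omega), T, map_zero,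
        LinearMap.zero_apply, hc.prod_T hw hσw, eq_comm, neg_add_eq_zero] at h1
      rw [hc.prod_T hw (hc.T_mem hσw), ← h1, smul_smul, neg_smul,
        show 2 * (n : ℤ) + 3 - 1 - 1 = 2 * n + 1 by ring]
      congr 2
      push_cast; ring
    have e4 := hh.quasiPrimary_pos hq hL (l := 2 * n + 3) (by ring)
    have hsum : ((n : ℤ) + 2).negOnePow •
          h (prod ℂ (2 * n + 3) u (σ.toFun u)) (vac ℂ V) =
        h (σ.toFun q) (σ.toFun q) + (((2 * n + 3) * (2 * n + 2) : ℝ) : ℂ) *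
          (((n : ℤ) + 1).negOnePow • h (prod ℂ (2 * n + 1) w (σ.toFun w)) (vac ℂ V)) := by
      rw [← e4]
      -- The sign change between consecutive weights cancels the minus sign in `e3`.
      have hs : ((n : ℤ) + 2).negOnePow = -((n : ℤ) + 1).negOnePow := by
        rw [show (n : ℤ) + 2 = n + 1 + 1 by ring, Int.negOnePow_succ]
      rw [hu', map_add σ.toFun, σ.map_T, hs]
      simp only [map_add, LinearMap.add_apply, e1, e2, e3, map_smul, LinearMap.smul_apply,
        Units.smul_def, zsmul_eq_mul, smul_eq_mul, Units.val_neg, Int.cast_neg]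
      ring
    have hcast : ((n + 1 : ℕ) : ℤ) + 1 = n + 2 := by push_cast; ring
    have hcast' : 2 * ((n + 1 : ℕ) : ℤ) + 1 = 2 * n + 3 := by push_cast; ring
    rw [hcast, hcast', hsum, Complex.add_re, Complex.re_ofReal_mul]
    have hc2 : (0 : ℝ) < (2 * n + 3) * (2 * n + 2) := by positivity
    by_cases hw0 : w = 0
    · have hq0 : q ≠ 0 := by
        rintro rfl
        rw [hu', hw0] at hne
        simp [T] at hne
      have := hh.pos _ (σ.map_ne_zero hq0)
      rw [hw0]
      simpa using this
    · exact add_pos_of_nonneg_of_pos (hh.nonneg _) (mul_pos hc2 (ih w hw hw0))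

end IsInvariantForm

/-- On vectors fixed by `σ`, the contraction to the vacuum is anisotropic. -/
theorem IsUnitary.eq_zero_of_prod_self {σ : AntiInvolution ω} (hσ : σ.IsUnitary)
    (hω : IsStrongCFTType ℂ ω) {m k : ℤ} (hm : 0 < m) (hk : k = 2 * m - 1) {u : V}
    (hu : u ∈ wt ℂ ω m) (hfix : σ.toFun u = u) (h0 : prod ℂ k u u = 0) : u = 0 := by
  obtain ⟨h, h1, h2, h3⟩ := hσ
  by_contra hne
  obtain ⟨n, rfl⟩ : ∃ n : ℕ, m = n + 1 := ⟨(m - 1).toNat, by omega⟩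
  have := IsInvariantForm.prod_conj_pos (σ := σ) (h := h) ⟨h1, h2, h3⟩ hω n u hu hne
  rw [hfix, show 2 * (n : ℤ) + 1 = k by omega, h0] at this
  simp at this

end AntiInvolution

/-! ### Filtered automorphisms and their graded parts -/

section Graded

variable {K V : Type*} [Field K] [AddCommGroup V] [Module K V] [VertexAlgebra K V] {ω : V}

theorem Aut.map_prod (f : Aut K V) (n : ℤ) (a b : V) :
    f.1 (prod K n a b) = prod K n (f.1 a) (f.1 b) := f.2.2 n a b

theorem Aut.map_vac (f : Aut K V) : f.1 (vac K V) = vac K V := f.2.1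

theorem Aut.map_T (f : Aut K V) (a : V) : f.1 (T K a) = T K (f.1 a) := by
  rw [T, Aut.map_prod f, Aut.map_vac f]; rfl

theorem Aut.map_apply_prod_zero (hω : IsConformal K ω) (f : Aut K V) (b : V) :
    prod K 0 (f.1 ω) b = T K b := by
  have h := Aut.map_prod f 0 ω (f.1.symm b)
  rw [hω.prod_zero, Aut.map_T f, f.1.apply_symm_apply] at h
  exact h.symm

theorem AutOmega.map_mem_wt {f : Aut K V} (hf : f ∈ AutOmega K ω) {n : ℤ} {v : V}
    (hv : v ∈ wt K ω n) : f.1 v ∈ wt K ω n := by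
  have h := Aut.map_prod f 1 ω v
  rw [mem_wt.1 hv, map_smul, show f.1 ω = ω from hf] at h
  exact mem_wt.2 h.symm

theorem map_mem_wtLT {f : V →ₗ[K] V} (hf : ∀ n, ∀ v ∈ wt K ω n, f v ∈ wt K ω n) {n : ℤ} {v : V}
    (hv : v ∈ wtLT K ω n) : f v ∈ wtLT K ω n := by
  have : wtLT K ω n ≤ (wtLT K ω n).comap f :=
    wtLT_le fun k hk x hx => wt_le_wtLT ω hk (hf k x hx)
  exact this hv

namespace IsConformal

/-- The grading, as an isomorphism with the direct sum of the weight spaces. -/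
noncomputable def toDirectSum (hω : IsConformal K ω) : V ≃ₗ[K] DirectSum ℤ (fun n => wt K ω n) :=
  (LinearEquiv.ofBijective (DirectSum.coeLinearMap (wt K ω))
    (show Function.Bijective (DirectSum.coeLinearMap (wt K ω)) from hω.internal)).symm

/-- The projection to the weight space of weight `n`. -/
noncomputable def proj (hω : IsConformal K ω) (n : ℤ) : V →ₗ[K] V :=
  (wt K ω n).subtype ∘ₗ DirectSum.component K ℤ (fun n => wt K ω n) n ∘ₗ
    hω.toDirectSum.toLinearMap

theorem toDirectSum_coe (hω : IsConformal K ω) {n : ℤ} (v : wt K ω n) :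
    hω.toDirectSum (v : V) =
      DirectSum.lof K ℤ (fun n => wt K ω n) n v := by
  rw [toDirectSum, LinearEquiv.symm_apply_eq, LinearEquiv.ofBijective_apply,
    DirectSum.coeLinearMap_lof]

theorem proj_of_mem (hω : IsConformal K ω) {n : ℤ} {v : V} (hv : v ∈ wt K ω n) :
    hω.proj n v = v := by
  have := hω.toDirectSum_coe ⟨v, hv⟩
  simp only at this
  simp [proj, this, DirectSum.component.lof_self]

theorem proj_of_mem_wtLT (hω : IsConformal K ω) {n : ℤ} {v : V} (hv : v ∈ wtLT K ω n) :
    hω.proj n v = 0 := by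
  have : wtLT K ω n ≤ LinearMap.ker (hω.proj n) := wtLT_le fun k hk x hx => by
    have := hω.toDirectSum_coe ⟨x, hx⟩
    simp only at this
    simp [proj, this, DirectSum.component.of, hk.ne]
  exact this hv

/-- The degree-preserving part `⨁ pr_n ∘ f|_{V_n}` of a linear map `f`. -/
noncomputable def grade (hω : IsConformal K ω) (f : V →ₗ[K] V) : V →ₗ[K] V :=
  DirectSum.toModule K ℤ V (fun n => hω.proj n ∘ₗ f ∘ₗ (wt K ω n).subtype) ∘ₗ
    hω.toDirectSum.toLinearMap

theorem grade_apply (hω : IsConformal K ω) (f : V →ₗ[K] V) {n : ℤ} {v : V}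
    (hv : v ∈ wt K ω n) : hω.grade f v = hω.proj n (f v) := by
  have := hω.toDirectSum_coe ⟨v, hv⟩
  simp only at this
  simp [grade, this, DirectSum.toModule_lof]

theorem grade_eq (hω : IsConformal K ω) (f : V →ₗ[K] V) {n : ℤ} {v u : V}
    (hv : v ∈ wt K ω n) (hu : u ∈ wt K ω n) (h : f v - u ∈ wtLT K ω n) : hω.grade f v = u := by
  rw [hω.grade_apply f hv, ← sub_add_cancel (f v) u, map_add, hω.proj_of_mem_wtLT h,
    hω.proj_of_mem hu, zero_add]

theorem grade_spec (hω : IsConformal K ω) {f : V →ₗ[K] V} {n : ℤ} {v : V} (hv : v ∈ wt K ω n)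
    (hf : f v ∈ wtLT K ω (n + 1)) :
    hω.grade f v ∈ wt K ω n ∧ f v - hω.grade f v ∈ wtLT K ω n := by
  obtain ⟨u, hu, y, hy, hxy⟩ := exists_add_of_mem_wtLT hf
  have h : f v - u ∈ wtLT K ω n := by rw [← hxy]; simpa using hy
  rw [hω.grade_eq f hv hu h]
  exact ⟨hu, h⟩

theorem grade_grade (hω : IsConformal K ω) {f g : V →ₗ[K] V}
    (hf : ∀ n, ∀ v ∈ wt K ω n, f v ∈ wtLT K ω (n + 1))
    (hg : ∀ n, ∀ v ∈ wt K ω n, g v ∈ wtLT K ω (n + 1)) (hfg : ∀ v, f (g v) = v) :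
    hω.grade f ∘ₗ hω.grade g = LinearMap.id := by
  refine hω.linearMap_ext fun n v hv => ?_
  obtain ⟨h1, h2⟩ := hω.grade_spec hv (hg n v hv)
  refine hω.grade_eq f h1 hv ?_
  have h3 : wtLT K ω n ≤ (wtLT K ω n).comap f := wtLT_le fun k hk x hx =>
    wtLT_mono ω (by omega) (hf k x hx)
  have h4 := Submodule.neg_mem _ (h3 h2)
  simpa [hfg] using h4

/-- Replacing each f(a) by its leading term changes a product only below its expected weight. -/
theorem grade_prod (hω : IsConformal K ω) {f : Aut K V}
    (hf : ∀ n, ∀ v ∈ wt K ω n, f.1 v ∈ wtLT K ω (n + 1)) (k : ℤ) (a b : V) :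
    hω.grade f.1.toLinearMap (prod K k a b) =
      prod K k (hω.grade f.1.toLinearMap a) (hω.grade f.1.toLinearMap b) := by
  set h := hω.grade f.1.toLinearMap with hh
  have key : (prod K k).compr₂ h = (prod K k).compl₁₂ h h := by
    refine hω.linearMap_ext fun n a ha => hω.linearMap_ext fun m b hb => ?_
    obtain ⟨ha1, ha2⟩ := hω.grade_spec ha (hf n a ha)
    obtain ⟨hb1, hb2⟩ := hω.grade_spec hb (hf m b hb)
    refine hω.grade_eq _ (hω.prod_mem _ _ k _ _ ha hb) (hω.prod_mem _ _ k _ _ ha1 hb1) ?_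
    change f.1 (prod K k a b) - prod K k (h a) (h b) ∈ _
    have e : f.1 (prod K k a b) - prod K k (h a) (h b) =
        prod K k (f.1 a - h a) (f.1 b) + prod K k (h a) (f.1 b - h b) := by
      rw [Aut.map_prod f]
      simp only [map_sub, LinearMap.sub_apply]
      abel
    rw [e]
    exact Submodule.add_mem _ (hω.prod_mem_wtLT (by omega) ha2 (hf m b hb))
      (hω.prod_mem_wtLT (by omega) (wt_le_wtLT ω (lt_add_one n) ha1) hb2)
  exact LinearMap.congr_fun (LinearMap.congr_fun key a) b

/-- The degree-preserving part of a filtered automorphism, as an automorphism. -/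
noncomputable def gradeAut (hω : IsConformal K ω) (f : Aut K V)
    (hf : ∀ n, ∀ v ∈ wt K ω n, f.1 v ∈ wtLT K ω (n + 1))
    (hf' : ∀ n, ∀ v ∈ wt K ω n, (f⁻¹).1 v ∈ wtLT K ω (n + 1)) : Aut K V :=
  ⟨LinearEquiv.ofLinearMap (hω.grade f.1.toLinearMap) (hω.grade (f⁻¹).1.toLinearMap)
      (hω.grade_grade hf hf' f.1.apply_symm_apply) (hω.grade_grade hf' hf f.1.symm_apply_apply),
    by
      refine hω.grade_eq _ hω.vac_mem hω.vac_mem ?_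
      change f.1 (vac K V) - _ ∈ _
      rw [Aut.map_vac f, sub_self]
      exact Submodule.zero_mem _,
    hω.grade_prod hf⟩

/-- An automorphism that moves `ω` by lower order terms preserves the filtration. -/
theorem map_mem_wtLT_of_sub_mem [CharZero K] (hω : IsConformal K ω) {f : Aut K V}
    (hf : f.1 ω - ω ∈ wtLT K ω 2) (n : ℤ) (v : V) (hv : v ∈ wt K ω n) :
    f.1 v ∈ wtLT K ω (n + 1) := by
  have step : ∀ m : ℕ, f.1 v ∈ wtLT K ω (n + 1 + m) → f.1 v ∈ wtLT K ω (n + 1) := by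
    intro m
    induction m with
    | zero => intro h; simpa using h
    | succ m ih =>
      intro h
      apply ih
      obtain ⟨u, hu, y, hy, hxy⟩ := exists_add_of_mem_wtLT (n := n + 1 + m)
        (by convert h using 2; push_cast; ring)
      have h1 : prod K 1 (f.1 ω) (f.1 v) = (n : K) • f.1 v := by
        rw [← Aut.map_prod f, mem_wt.1 hv, map_smul]
      -- f(v) is an eigenvector of f(ω)(1) for n, but on its top component u this operator acts to
      -- leading order as L(0), with eigenvalue n + 1 + m ≠ n; hence u = 0.
      have h2 : ((n + 1 + m : ℤ) : K) • u - (n : K) • u =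
          (n : K) • y - prod K 1 ω y - prod K 1 (f.1 ω - ω) (f.1 v) := by
        rw [← mem_wt.1 hu, map_sub, LinearMap.sub_apply, h1, ← hxy]
        simp only [map_add, smul_add]
        abel
      rw [← sub_smul] at h2
      have h3 : (((n + 1 + m : ℤ) : K) - n) • u = 0 := by
        refine hω.eq_zero_of_mem (Submodule.smul_mem _ _ hu) ?_
        rw [h2]
        refine Submodule.sub_mem _ (Submodule.sub_mem _ (Submodule.smul_mem _ _ hy) ?_) ?_
        · exact hω.prod_mem_wtLT (by omega) (wt_le_wtLT ω (by norm_num : (2 : ℤ) < 3) hω.self_mem)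
            hy
        · exact hω.prod_mem_wtLT (m := n + 1 + m + 1) (by omega) hf
            (by convert h using 2; push_cast; ring)
      have h4 : (((n + 1 + m : ℤ) : K) - n) ≠ 0 := by
        have : ((n + 1 + m : ℤ) : K) - n = ((m + 1 : ℕ) : K) := by push_cast; ring
        rw [this]
        exact Nat.cast_ne_zero.2 m.succ_ne_zero
      rw [smul_eq_zero_iff_right h4] at h3
      rw [← hxy, h3, zero_add]
      exact hy
  obtain ⟨M, hM⟩ := hω.exists_mem_wtLT (f.1 v)
  exact step (M - (n + 1)).toNat (wtLT_mono ω (by omega) hM)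

/-- Fixing ω preserves weights, so f(v) - v has the weight of v and also lies strictly below it. -/
theorem disjoint_autMinus_autOmega (hω : IsConformal K ω) :
    Disjoint (AutMinus hω) (AutOmega K ω) := by
  rw [Subgroup.disjoint_def]
  intro f hf hf'
  have : f.1.toLinearMap = LinearMap.id := hω.linearMap_ext fun n v hv =>
    sub_eq_zero.1 (hω.eq_zero_of_mem
      (Submodule.sub_mem _ (AutOmega.map_mem_wt hf' hv) hv) (hf n v hv))
  exact Subtype.ext (LinearEquiv.toLinearMap_injective this)

theorem conj_mem_autMinus (hω : IsConformal K ω) {f g : Aut K V} (hf : f ∈ AutMinus hω)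
    (hg : g ∈ AutOmega K ω) : g * f * g⁻¹ ∈ AutMinus hω := by
  intro n v hv
  have hv' := AutOmega.map_mem_wt ((AutOmega K ω).inv_mem hg) hv
  have h := map_mem_wtLT (f := g.1.toLinearMap) (fun _ _ => AutOmega.map_mem_wt hg)
    (hf n _ hv')
  have e : g.1 ((g⁻¹).1 v) = v := g.1.apply_symm_apply v
  rw [map_sub] at h
  change g.1 (f.1 ((g⁻¹).1 v)) - g.1 ((g⁻¹).1 v) ∈ _ at h
  rw [e] at h
  exact h

theorem exists_mul_eq (hω : IsConformal K ω) {f : Aut K V}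
    (hf : ∀ n, ∀ v ∈ wt K ω n, f.1 v ∈ wtLT K ω (n + 1))
    (hf' : ∀ n, ∀ v ∈ wt K ω n, (f⁻¹).1 v ∈ wtLT K ω (n + 1))
    (hfω : f.1 ω - ω ∈ wtLT K ω 2) : ∃ g ∈ AutMinus hω, ∃ h ∈ AutOmega K ω, g * h = f := by
  have hh : hω.gradeAut f hf hf' ∈ AutOmega K ω :=
    hω.grade_eq _ hω.self_mem hω.self_mem hfω
  refine ⟨f * (hω.gradeAut f hf hf')⁻¹, fun n v hv => ?_, _, hh, inv_mul_cancel_right _ _⟩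
  have hv' := AutOmega.map_mem_wt ((AutOmega K ω).inv_mem hh) hv
  have h := (hω.grade_spec hv' (hf n _ hv')).2
  have e : hω.grade f.1.toLinearMap (((hω.gradeAut f hf hf')⁻¹).1 v) = v :=
    (hω.gradeAut f hf hf').1.apply_symm_apply v
  change f.1 _ - _ ∈ _ at h
  rw [e] at h
  exact h

/-- If every automorphism moves `ω` only by lower order terms, then `Aut⁻ V` is a normal complement
of `Aut_ω V`. -/
theorem normal_and_isComplement' [CharZero K] (hω : IsConformal K ω)
    (h : ∀ f : Aut K V, f.1 ω - ω ∈ wtLT K ω 2) :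
    (AutMinus hω).Normal ∧ (AutMinus hω).IsComplement' (AutOmega K ω) := by
  have key : ∀ f : Aut K V, ∃ g ∈ AutMinus hω, ∃ h ∈ AutOmega K ω, g * h = f := fun f =>
    hω.exists_mul_eq (hω.map_mem_wtLT_of_sub_mem (h f)) (hω.map_mem_wtLT_of_sub_mem (h f⁻¹)) (h f)
  refine ⟨⟨fun n hn f => ?_⟩,
    Subgroup.isComplement'_of_disjoint_and_mul_eq_univ hω.disjoint_autMinus_autOmega
      (Set.eq_univ_of_forall fun f => ?_)⟩
  · obtain ⟨g, hg, k, hk, rfl⟩ := key f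
    have := mul_mem (mul_mem hg (hω.conj_mem_autMinus hn hk)) (inv_mem hg)
    convert this using 1
    group
  · obtain ⟨g, hg, k, hk, rfl⟩ := key f
    exact Set.mul_mem_mul hg hk

end IsConformal

end Graded

/-! ### The image of ω under automorphisms of the real form -/

namespace AntiInvolution

variable {V : Type*} [AddCommGroup V] [Module ℂ V] [VertexAlgebra ℂ V] {ω : V}

/-- Skew-symmetry turns d(0)ω = 0 into Td = (L(1)d)(-3)𝟏 = ½T²L(1)d. Since T is injective in
positive weight, d = ½TL(1)d. -/
theorem IsInvariantForm.exists_eq_T {σ : AntiInvolution ω} {h : V →ₗ[ℂ] V →ₛₗ[starRingEnd ℂ] ℂ}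
    (hh : σ.IsInvariantForm h) (hω : IsCFTType ℂ ω) {d : V} (hd : d ∈ wt ℂ ω 2)
    (h0 : prod ℂ 0 d ω = 0) : ∃ x ∈ wt ℂ ω 1, d = T ℂ x := by
  have hc := hω.toIsConformal
  have hx : L ℂ ω 1 d ∈ wt ℂ ω 1 := hc.L_mem (by norm_num) hd
  have key : T ℂ d = prod ℂ (-3) (L ℂ ω 1 d) (vac ℂ V) := by
    have hs := skew_symmetry (K := ℂ) 0 ω d
    rw [h0, smul_zero, neg_zero, finsum_eq_sum_of_support_subset (s := Finset.range 3) _ (by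
      intro i hi
      by_contra hi2
      apply hi
      have h2 : 3 ≤ i := by simpa using hi2
      -- For i = 3, ω(3)d is a multiple of 𝟏, and 𝟏(-4)𝟏 = 0; for larger i the weight is negative.
      rcases h2.eq_or_lt with rfl | h2
      · have h3 : prod ℂ (0 + (3 : ℕ)) ω d ∈ wt ℂ ω 0 := by
          simpa using hc.prod_mem 2 2 (0 + (3 : ℕ)) ω d hc.self_mem hd
        rw [hω.wt_zero] at h3
        obtain ⟨c, hc3⟩ := Submodule.mem_span_singleton.1 h3
        simp only
        rw [← hc3, map_smul, LinearMap.smul_apply, vac_prod, if_neg (by norm_num), smul_zero,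
          smul_zero]
      · simp only
        rw [hω.eq_zero_of_neg (n := 2 + 2 - (0 + (i : ℤ)) - 1) (by omega)
          (hc.prod_mem 2 2 _ ω d hc.self_mem hd)]
        simp)] at hs
    simp only [Finset.sum_range_succ, Finset.sum_range_zero] at hs
    norm_num at hs
    rw [prod_vac_neg_one, hc.prod_zero, mem_wt.1 hd, map_smul, LinearMap.smul_apply] at hs
    change T ℂ d + -(((2 : ℤ) : ℂ) • T ℂ d) + prod ℂ (-3) (L ℂ ω 1 d) (vac ℂ V) = 0 at hs
    rw [← sub_eq_zero, ← neg_eq_zero, ← hs]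
    push_cast
    module
  have h2 := hc.prod_T hx hc.vac_mem (-2)
  norm_num at h2
  rw [← key] at h2
  have hTx : T ℂ (L ℂ ω 1 d) ∈ wt ℂ ω 2 := by
    have := hc.T_mem hx
    rwa [one_add_one_eq_two] at this
  have h3 : (2 : ℂ) • d - T ℂ (L ℂ ω 1 d) = 0 := by
    refine hh.eq_zero_of_L_one_T hc (n := 2) (by norm_num)
      (Submodule.sub_mem _ (Submodule.smul_mem _ _ hd) hTx) ?_
    have h4 : T ℂ ((2 : ℂ) • d - T ℂ (L ℂ ω 1 d)) =
        (2 : ℂ) • T ℂ d - prod ℂ (-2) (T ℂ (L ℂ ω 1 d)) (vac ℂ V) := by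
      simp only [T, map_sub, map_smul, LinearMap.sub_apply, LinearMap.smul_apply]
    rw [h4, h2, sub_self, map_zero]
  refine ⟨(2⁻¹ : ℂ) • L ℂ ω 1 d, Submodule.smul_mem _ _ hx, ?_⟩
  rw [sub_eq_zero] at h3
  rw [T, map_smul, LinearMap.smul_apply, ← T, ← h3, smul_smul]
  norm_num

/-- With d = Tx, ω(3)d = L(2)Tx = TL(2)x + 3L(1)x. The first term vanishes by weight and the second
by strong CFT type, so d(3)d is all that remains of the difference in `h3`. -/
theorem IsUnitary.eq_zero_of_add_prod_self {σ : AntiInvolution ω} (hσ : σ.IsUnitary)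
    (hω : IsStrongCFTType ℂ ω) {d : V} (hd : d ∈ wt ℂ ω 2) (hfix : σ.toFun d = d)
    (h0 : prod ℂ 0 d ω = 0) (h3 : prod ℂ 3 (ω + d) (ω + d) = prod ℂ 3 ω ω) : d = 0 := by
  have hc := hω.toIsConformal
  have hx : ∃ x ∈ wt ℂ ω 1, d = T ℂ x := by
    obtain ⟨h, h1, h2, h3⟩ := hσ
    exact IsInvariantForm.exists_eq_T (σ := σ) (h := h) ⟨h1, h2, h3⟩ hω.toIsCFTType hd h0
  obtain ⟨x, hx, hdx⟩ := hx
  have e1 : prod ℂ 3 ω d = 0 := by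
    have h4 := hc.L_T (n := 2) (by norm_num) x
    rw [hω.eq_zero_of_neg (n := -1) (by norm_num) (hc.L_mem (by norm_num) hx),
      show L ℂ ω (2 - 1) x = L ℂ ω 1 x from rfl, hω.L_one x hx, ← hdx] at h4
    rw [T, map_zero, LinearMap.zero_apply, smul_zero, add_zero] at h4
    exact h4
  have e2 : prod ℂ 3 d ω = 0 := by
    rw [hc.prod_comm_of_degree_zero hω.wt_neg (by norm_num) hd hc.self_mem, e1]
    simp
  refine hσ.eq_zero_of_prod_self hω (m := 2) (k := 3) (by norm_num) (by norm_num) hd hfix ?_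
  simpa [e1, e2] using h3

section RealForm

variable {σ : AntiInvolution ω}

theorem realForm_eq_zero_of_neg (σ : AntiInvolution ω) (hω : IsCFTType ℂ ω) {n : ℤ} (hn : n < 0) :
    wt ℝ σ.omega n = ⊥ := by
  rw [eq_bot_iff]
  intro a ha
  exact Subtype.ext (hω.eq_zero_of_neg hn ((σ.mem_wt_iff n a).1 ha))

theorem realForm_wt_zero (hω : IsCFTType ℂ ω) {a : σ.realForm} (ha : a ∈ wt ℝ σ.omega 0) :
    ∃ r : ℝ, a = r • vac ℝ σ.realForm := by
  rw [mem_wt_iff, hω.wt_zero] at ha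
  obtain ⟨c, hc⟩ := Submodule.mem_span_singleton.1 ha
  have h1 : conj c • vac ℂ V = c • vac ℂ V := by
    have := congrArg σ.toFun hc
    rw [LinearMap.map_smulₛₗ, σ.map_vac, show σ.toFun a = a from a.2, ← hc] at this
    exact this
  refine ⟨c.re, Subtype.ext ?_⟩
  change (a : V) = (c.re : ℂ) • vac ℂ V
  rw [← hc, show (c.re : ℂ) = 2⁻¹ * (c + conj c) by rw [Complex.add_conj]; push_cast; ring,
    mul_smul, add_smul,
    h1, ← two_smul ℂ, smul_smul]
  norm_num

theorem map_omega_mem_wtLT_three (hσ : σ.IsUnitary) (hω : IsStrongCFTType ℂ ω)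
    (f : Aut ℝ σ.realForm) : f.1 σ.omega ∈ wtLT ℝ σ.omega 3 := by
  have hc := σ.isConformal_omega hω.toIsConformal
  have hneg : ∀ n < 0, wt ℝ σ.omega n = ⊥ := fun n hn => σ.realForm_eq_zero_of_neg hω.toIsCFTType hn
  have step : ∀ m : ℕ, f.1 σ.omega ∈ wtLT ℝ σ.omega (3 + m) →
      f.1 σ.omega ∈ wtLT ℝ σ.omega 3 := by
    intro m
    induction m with
    | zero => intro h; simpa using h
    | succ m ih =>
      intro h
      apply ih
      have h' : f.1 σ.omega ∈ wtLT ℝ σ.omega (3 + m + 1) := by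
        convert h using 2; push_cast; ring
      obtain ⟨u, hu, y, hy, hxy⟩ := exists_add_of_mem_wtLT h'
      -- This product takes two vectors of weight 3 + m to weight 0, so every term involving lower
      -- components has negative weight.
      obtain ⟨k, hk⟩ : ∃ k : ℤ, k = 2 * (3 + m) - 1 := ⟨_, rfl⟩
      have h1 : prod ℝ k (f.1 σ.omega) (f.1 σ.omega) = 0 := by
        have h2 := hc.prod_mem 2 2 k _ _ hc.self_mem hc.self_mem
        rw [hneg _ (by omega), Submodule.mem_bot] at h2
        rw [← Aut.map_prod, h2, map_zero]
      have h3 : prod ℝ k u u = -prod ℝ k u y - prod ℝ k y (f.1 σ.omega) := by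
        rw [← hxy] at h1 ⊢
        simp only [map_add, LinearMap.add_apply] at h1 ⊢
        rw [← sub_eq_zero, ← h1]
        abel
      have h4 : prod ℝ k u u ∈ wtLT ℝ σ.omega 0 := by
        rw [h3]
        exact Submodule.sub_mem _ (Submodule.neg_mem _
          (hc.prod_mem_wtLT (by omega) (wt_le_wtLT _ (lt_add_one _) hu) hy))
          (hc.prod_mem_wtLT (by omega) hy h')
      rw [wtLT_zero_eq_bot hneg, Submodule.mem_bot] at h4
      have h5 : u = 0 := Subtype.ext (hσ.eq_zero_of_prod_self hω (m := 3 + m) (by omega) hk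
        ((σ.mem_wt_iff _ _).1 hu) u.2 (congrArg Subtype.val h4))
      rw [← hxy, h5, zero_add]
      exact hy
  obtain ⟨M, hM⟩ := hc.exists_mem_wtLT (f.1 σ.omega)
  exact step (M - 3).toNat (wtLT_mono _ (by omega) hM)

/-- Every automorphism of `V^σ` moves `ω` only by terms of weight less than two. -/
theorem map_omega_sub_mem_wtLT (hσ : σ.IsUnitary) (hω : IsStrongCFTType ℂ ω)
    (f : Aut ℝ σ.realForm) : f.1 σ.omega - σ.omega ∈ wtLT ℝ σ.omega 2 := by
  have hc := σ.isConformal_omega hω.toIsConformal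
  have hneg : ∀ n < 0, wt ℝ σ.omega n = ⊥ := fun n hn => σ.realForm_eq_zero_of_neg hω.toIsCFTType hn
  have h3 := map_omega_mem_wtLT_three hσ hω f
  obtain ⟨u, hu, y, hy, hxy⟩ := exists_add_of_mem_wtLT (n := 2) h3
  obtain ⟨d, hd⟩ : ∃ d, d = u - σ.omega := ⟨_, rfl⟩
  have hu' : u = σ.omega + d := by rw [hd]; abel
  have hd2 : d ∈ wt ℝ σ.omega 2 := by
    rw [hd]; exact Submodule.sub_mem _ hu hc.self_mem
  have hω3 : σ.omega ∈ wtLT ℝ σ.omega 3 := wt_le_wtLT _ (by norm_num) hc.self_mem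
  have e0 : prod ℝ 0 d σ.omega = 0 := by
    have h1 := Aut.map_apply_prod_zero hc f σ.omega
    rw [← hxy, hu', ← hc.prod_zero] at h1
    simp only [map_add, LinearMap.add_apply] at h1
    rw [add_assoc, add_eq_left] at h1
    refine hc.eq_zero_of_mem (n := 3) (hc.prod_mem 2 2 0 _ _ hd2 hc.self_mem) ?_
    rw [eq_neg_of_add_eq_zero_left h1]
    exact Submodule.neg_mem _ (hc.prod_mem_wtLT (by norm_num) hy hω3)
  have e3 : prod ℝ 3 u u = prod ℝ 3 σ.omega σ.omega := by
    have h1 : prod ℝ 3 (f.1 σ.omega) (f.1 σ.omega) = prod ℝ 3 σ.omega σ.omega := by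
      -- ω(3)ω is a multiple of the vacuum, hence fixed by `f`.
      obtain ⟨r, hr⟩ := realForm_wt_zero hω.toIsCFTType
        (hc.prod_mem 2 2 3 _ _ hc.self_mem hc.self_mem)
      rw [← Aut.map_prod, hr, map_smul, Aut.map_vac]
    have h2 : prod ℝ 3 (f.1 σ.omega) (f.1 σ.omega) - prod ℝ 3 u u =
        prod ℝ 3 u y + prod ℝ 3 y (f.1 σ.omega) := by
      rw [← hxy]
      simp only [map_add, LinearMap.add_apply]
      abel
    have h4 : prod ℝ 3 (f.1 σ.omega) (f.1 σ.omega) - prod ℝ 3 u u ∈ wtLT ℝ σ.omega 0 := by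
      rw [h2]
      exact Submodule.add_mem _
        (hc.prod_mem_wtLT (n := 3) (by norm_num) (wt_le_wtLT _ (by norm_num) hu) hy)
        (hc.prod_mem_wtLT (by norm_num) hy h3)
    rw [wtLT_zero_eq_bot hneg, Submodule.mem_bot, sub_eq_zero] at h4
    rw [← h4, h1]
  rw [hu'] at e3
  have hd0 : d = 0 := Subtype.ext (hσ.eq_zero_of_add_prod_self hω ((σ.mem_wt_iff _ _).1 hd2) d.2
    (congrArg Subtype.val e0) (congrArg Subtype.val e3))
  rw [← hxy, hu', hd0]
  simpa using hy

theorem mem_J₁_of_prod_zero {a : σ.realForm} (ha : a ∈ wt ℝ σ.omega 1)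
    (h0 : ∀ b, prod ℝ 0 a b = 0) : (a : V) ∈ J₁ ℂ ω := by
  refine ⟨(σ.mem_wt_iff _ _).1 ha, ?_⟩
  rw [SetLike.mem_coe, LinearMap.mem_ker]
  ext v
  -- Both v + σ(v) and i(v - σ(v)) lie in V^σ, and together they span v over ℂ.
  have h1 : prod ℂ 0 (a : V) (v + σ.toFun v) = 0 :=
    congrArg Subtype.val (h0 ⟨v + σ.toFun v, by
      change σ.toFun _ = _
      rw [map_add, σ.involutive, add_comm]⟩)
  have h2 : prod ℂ 0 (a : V) (Complex.I • (v - σ.toFun v)) = 0 :=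
    congrArg Subtype.val (h0 ⟨Complex.I • (v - σ.toFun v), by
      change σ.toFun _ = _
      rw [LinearMap.map_smulₛₗ, map_sub, σ.involutive, Complex.conj_I, neg_smul, ← smul_neg,
        neg_sub]⟩)
  rw [map_smul, smul_eq_zero_iff_right Complex.I_ne_zero] at h2
  have h3 : (2 : ℂ) • prod ℂ 0 (a : V) v = 0 := by
    rw [← map_smul, show (2 : ℂ) • v = (v + σ.toFun v) + (v - σ.toFun v) by module, map_add, h1, h2,
      add_zero]
  simpa using h3

/-- If `J₁(V) = 0`, then every automorphism of `V^σ` fixes `ω`. -/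
theorem autOmega_eq_top (hσ : σ.IsUnitary) (hω : IsStrongCFTType ℂ ω) (hJ : J₁ ℂ ω = ⊥) :
    AutOmega ℝ σ.omega = ⊤ := by
  have hc := σ.isConformal_omega hω.toIsConformal
  have hneg : ∀ n < 0, wt ℝ σ.omega n = ⊥ := fun n hn => σ.realForm_eq_zero_of_neg hω.toIsCFTType hn
  rw [eq_top_iff]
  intro f _
  obtain ⟨u, hu, y, hy, hxy⟩ :=
    exists_add_of_mem_wtLT (n := 1) (map_omega_sub_mem_wtLT hσ hω f)
  obtain ⟨z, hz, y', hy', hzy⟩ := exists_add_of_mem_wtLT (n := 0) hy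
  rw [wtLT_zero_eq_bot hneg, Submodule.mem_bot] at hy'
  rw [hy', add_zero] at hzy
  obtain ⟨r, hr⟩ := realForm_wt_zero hω.toIsCFTType hz
  have hzn : ∀ k ≥ 0, ∀ b, prod ℝ k z b = 0 := fun k hk b => by
    rw [hr, map_smul, LinearMap.smul_apply, vac_prod_nonneg hk, smul_zero]
  have hu0 : ∀ b, prod ℝ 0 u b = 0 := fun b => by
    have h1 := Aut.map_apply_prod_zero hc f b
    rw [← hc.prod_zero, ← sub_eq_zero, ← LinearMap.sub_apply, ← map_sub, ← hxy, ← hzy, map_add,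
      LinearMap.add_apply, hzn 0 le_rfl, add_zero] at h1
    exact h1
  have hu1 := mem_J₁_of_prod_zero hu hu0
  rw [hJ, Submodule.mem_bot] at hu1
  have hu2 : u = 0 := Subtype.ext hu1
  rw [hu2, zero_add, ← hzy, eq_comm, sub_eq_iff_eq_add'] at hxy
  -- With f(ω) = ω + z and z a multiple of 𝟏, the left side is 2ω and the right side 2ω + 2z, so z =
  -- 0.
  have h2 : prod ℝ 1 (f.1 σ.omega) (f.1 σ.omega) = (2 : ℝ) • f.1 σ.omega := by
    rw [← Aut.map_prod, mem_wt.1 hc.self_mem, map_smul]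
    norm_num
  have hz1 : prod ℝ 1 σ.omega z = 0 := by
    rw [mem_wt.1 hz]; simp
  rw [hxy] at h2
  simp only [map_add, LinearMap.add_apply, hz1, hzn 1 zero_le_one, add_zero,
    mem_wt.1 hc.self_mem, smul_add] at h2
  norm_num at h2
  change f.1 σ.omega = σ.omega
  rw [hxy, h2, add_zero]

end RealForm

end AntiInvolution

end VertexAlgebra

theorem corollary7p6 {V : Type*} [AddCommGroup V] [Module ℂ V] [VertexAlgebra ℂ V]
    (ω : V) (hsimple : VertexAlgebra.IsSimple ℂ V)
    (hω : VertexAlgebra.IsStrongCFTType ℂ ω)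
    (σ : VertexAlgebra.AntiInvolution ω) (hσ : σ.IsUnitary) :
    (∃ φ : VertexAlgebra.AutOmega ℝ σ.omega →*
          MulAut (VertexAlgebra.AutMinus (σ.isConformal_omega hω.toIsConformal)),
        (∀ g f, ((φ g f : VertexAlgebra.AutMinus (σ.isConformal_omega hω.toIsConformal)) :
          VertexAlgebra.Aut ℝ σ.realForm) = g * f * (g : VertexAlgebra.Aut ℝ σ.realForm)⁻¹) ∧
        ∃ e : (VertexAlgebra.AutMinus (σ.isConformal_omega hω.toIsConformal) ⋊[φ]
            VertexAlgebra.AutOmega ℝ σ.omega) ≃* VertexAlgebra.Aut ℝ σ.realForm,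
          ∀ x, e x = (x.left : VertexAlgebra.Aut ℝ σ.realForm) * x.right) ∧
      (VertexAlgebra.J₁ ℂ ω = ⊥ → VertexAlgebra.AutOmega ℝ σ.omega = ⊤) := by
  obtain ⟨hnormal, hcompl⟩ := (σ.isConformal_omega hω.toIsConformal).normal_and_isComplement'
    (VertexAlgebra.AntiInvolution.map_omega_sub_mem_wtLT hσ hω)
  -- The action is read off from `SemidirectProduct.mulEquivSubgroup`, where it is conjugation by
  -- definition.
  exact ⟨⟨_, fun _ _ => rfl, SemidirectProduct.mulEquivSubgroup hcompl, fun _ => rfl⟩,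
    VertexAlgebra.AntiInvolution.autOmega_eq_top hσ hω⟩
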